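/- Let $M$ be a smooth finite-dimensional manifold (Hausdorff, second countable, without boundary), $E=TM\oplus T^*M$ with the pairing $\langle X+\xi,Y+\eta\rangle=\eta(X)+\xi(Y)$, and let $g$ be a pseudo-Riemannian metric on $M$ of arbitrary signature and $b$ a smooth $2$-form on $M$. Regard $g$ and $b$ as maps $TM\to T^*M$, $X\mapsto g(X,\cdot)$, $X\mapsto b(X,\cdot)$, and let $$G=\begin{pmatrix}-g^{-1}b & g^{-1}\\ g-bg^{-1}b & bg^{-1}\end{pmatrix}:E\to E$$ be the endomorphism induced by $(g,b)$. It satisfies $G^2=\mathrm{Id}$, and its $\pm1$-eigenbundles are $V^{\pm}=\{X\pm gX+bX\}$; write $X^{\pm}=X\pm gX+bX$. Let $[X+\xi,Y+\eta]_D=[X,Y]+\mathcal L_X\eta-\iota_Yd\xi$ and let $[v,w]_C=\frac12([v,w]_D-[w,v]_D)$ be the Courant bracket. Let $\nabla^+$ be the affine connection $\nabla^+_XY=\pi\big(\tfrac12(\mathrm{Id}+G)[X^-,Y^+]_C\big)$, where $\pi:E\to TM$ is the projection, and put $$[X+\xi,Y+\eta]_{\nabla^+}=[X,Y]+\nabla^+_X\eta-\nabla^+_Y\xi,\qquad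 \tilde\nabla_{X+\xi}(Y+\eta)=\nabla^+_XY+\nabla^+_X\eta .$$ $G$ is called $[\cdot,\cdot]_{\nabla^+}$-integrable if $$[Gv,Gw]_{\nabla^+}-G[Gv,w]_{\nabla^+}-G[v,Gw]_{\nabla^+}+G^2[v,w]_{\nabla^+}=0\quad\text{for all } v,w\in C^\infty(E),$$ and $[\cdot,\cdot]_C$-integrable if $C^\infty(V^+)$ is closed under $[\cdot,\cdot]_C$. Suppose that $\nabla^+b=0$ and $db=0$. Then: (i) $G$ is $[\cdot,\cdot]_{\nabla^+}$-integrable. (ii) If $\langle\tilde\nabla_uv,w\rangle=\langle\tilde\nabla_{Gu}v,Gw\rangle$ for all $u,v,w\in C^\infty(E)$, then $G$ is $[\cdot,\cdot]_C$-integrable. More precisely, this holds pair by pair: whenever $v,w\in C^\infty(V^+)$ satisfy $\langle\tilde\nabla_uv,w\rangle=\langle\tilde\nabla_{Gu}v,Gw\rangle$ and $\langle\tilde\nabla_uw,v\rangle=\langle\tilde\nabla_{Gu}w,Gv\rangle$ for all $u\in C^\infty(E)$, one has $[v,w]_C\in C^\infty(V^+)$. In particular, these integrability criteria hold irrespective of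 the signature of $g$. -/

import Mathlib

open Bundle
open scoped Manifold ContDiff Topology

noncomputable section

namespace GenGeom

section Calculus

variable {E : Type*} [NormedAddCommGroup E] [NormedSpace ℝ E]
  {M : Type*} [TopologicalSpace M] [ChartedSpace E M]

variable (E M) in
/-- (Not necessarily smooth) vector fields on `M`, i.e. sections of `TM`. -/
abbrev VField : Type _ := (x : M) → TangentSpace 𝓘(ℝ, E) x

variable (E M) in
/-- (Not necessarily smooth) one-forms on `M`, i.e. sections of `T*M`. -/
abbrev OneForm : Type _ := (x : M) → (TangentSpace 𝓘(ℝ, E) x →L[ℝ] ℝ)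

variable (E) in
/-- The fibre `T_xM ⊕ T_x*M` of the generalized tangent bundle. -/
abbrev GenFiber (x : M) : Type _ :=
  TangentSpace 𝓘(ℝ, E) x × (TangentSpace 𝓘(ℝ, E) x →L[ℝ] ℝ)

variable (E M) in
/-- (Not necessarily smooth) sections `X + ξ` of the generalized tangent bundle `TM ⊕ T*M`. -/
abbrev GenField : Type _ := (x : M) → GenFiber E x

variable [IsManifold 𝓘(ℝ, E) ∞ M]

/-- `X ∈ C^∞(TM)`. -/
def SmoothVField (X : VField E M) : Prop :=
  ContMDiff 𝓘(ℝ, E) (𝓘(ℝ, E).prod 𝓘(ℝ, E)) ∞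
    (fun x ↦ TotalSpace.mk' E x (X x))

/-- `ξ ∈ C^∞(T*M)`. -/
def SmoothOneForm (ξ : OneForm E M) : Prop :=
  ContMDiff 𝓘(ℝ, E) (𝓘(ℝ, E).prod 𝓘(ℝ, E →L[ℝ] ℝ)) ∞
    (fun x ↦ TotalSpace.mk' (E →L[ℝ] ℝ) x (ξ x))

/-- `X + ξ ∈ C^∞(TM ⊕ T*M)`. -/
def SmoothGenField (v : GenField E M) : Prop :=
  SmoothVField (fun x ↦ (v x).1) ∧ SmoothOneForm (fun x ↦ (v x).2)

/-- The derivative `X(f)` of a function along a vector field. -/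
def dirDeriv (X : VField E M) (f : M → ℝ) (x : M) : ℝ := mvfderiv 𝓘(ℝ, E) f x (X x)

/-- The function `ξ(X)`. -/
def evalForm (ξ : OneForm E M) (X : VField E M) (x : M) : ℝ := ξ x (X x)

/-- The Lie bracket of vector fields. -/
def lieBr (X Y : VField E M) : VField E M := VectorField.mlieBracket 𝓘(ℝ, E) X Y

variable [FiniteDimensional ℝ E]

open Classical in
/-- The one-form `θ` with `θ(Z) = Φ(Z)` for every vector field `Z`, where `Φ` is an operation from
vector fields to functions that is tensorial (additive and linear over functions).
The value is `0` at the points where `Φ` is not tensorial; this never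
happens below when the fields involved are smooth. -/
def formOf (Φ : VField E M → M → ℝ) : OneForm E M := fun x ↦
  have : IsManifold 𝓘(ℝ, E) 1 M := IsManifold.of_le (n := ∞) (by norm_cast)
  if h : TensorialAt 𝓘(ℝ, E) E (fun Z ↦ Φ Z x) x then
    TensorialAt.mkHom (fun Z ↦ Φ Z x) x h
  else 0

/-- The Lie derivative `L_X η` of a one-form: `(L_X η)(Z) = X(η(Z)) - η([X, Z])`. -/
def lieDerivForm (X : VField E M) (η : OneForm E M) : OneForm E M :=
  formOf fun Z x ↦ dirDeriv X (evalForm η Z) x - η x (lieBr X Z x)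

/-- The contraction `ι_Y dξ` of the exterior derivative of a one-form:
`(ι_Y dξ)(Z) = dξ(Y, Z) = Y(ξ(Z)) - Z(ξ(Y)) - ξ([Y, Z])`. -/
def contractD (Y : VField E M) (ξ : OneForm E M) : OneForm E M :=
  formOf fun Z x ↦ dirDeriv Y (evalForm ξ Z) x - dirDeriv Z (evalForm ξ Y) x - ξ x (lieBr Y Z x)

/-- The Dorfman bracket `[X + ξ, Y + η]_D = [X, Y] + L_X η - ι_Y dξ`. -/
def dorfman (v w : GenField E M) : GenField E M := fun x ↦
  (lieBr (fun y ↦ (v y).1) (fun y ↦ (w y).1) x,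
    lieDerivForm (fun y ↦ (v y).1) (fun y ↦ (w y).2) x
      - contractD (fun y ↦ (w y).1) (fun y ↦ (v y).2) x)

/-- The Courant bracket, the skew-symmetrization of the Dorfman bracket. -/
def courant (v w : GenField E M) : GenField E M := fun x ↦
  (1 / 2 : ℝ) • (dorfman v w x - dorfman w v x)

/-- The natural pairing `⟨X + ξ, Y + η⟩ = η(X) + ξ(Y)` on a fibre. -/
def pairing {x : M} (a c : GenFiber E x) : ℝ := c.2 a.1 + a.2 c.1

/-! ### Structures induced by an affine connection `∇`, given as the operation `(X, Y) ↦ ∇_X Y` -/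

/-- The covariant derivative of a one-form: `(∇_X η)(Z) = X(η(Z)) - η(∇_X Z)`. -/
def covForm (nabla : VField E M → VField E M → VField E M) (X : VField E M) (η : OneForm E M) :
    OneForm E M :=
  formOf fun Z x ↦ dirDeriv X (evalForm η Z) x - η x (nabla X Z x)

/-- The bracket `[X + ξ, Y + η]_∇ = [X, Y] + ∇_X η - ∇_Y ξ`. -/
def connBracket (nabla : VField E M → VField E M → VField E M) (v w : GenField E M) :
    GenField E M := fun x ↦
  (lieBr (fun y ↦ (v y).1) (fun y ↦ (w y).1) x,
    covForm nabla (fun y ↦ (v y).1) (fun y ↦ (w y).2) x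
      - covForm nabla (fun y ↦ (w y).1) (fun y ↦ (v y).2) x)

/-- The generalized connection `∇̃_{X + ξ} (Y + η) = ∇_X Y + ∇_X η`. -/
def genConn (nabla : VField E M → VField E M → VField E M) (v w : GenField E M) :
    GenField E M := fun x ↦
  (nabla (fun y ↦ (v y).1) (fun y ↦ (w y).1) x,
    covForm nabla (fun y ↦ (v y).1) (fun y ↦ (w y).2) x)

/-! ### Endomorphisms of the generalized tangent bundle -/

variable (E M) in
/-- (Not necessarily smooth) bundle endomorphisms of `TM ⊕ T*M`. -/
abbrev GenEndo : Type _ := (x : M) → (GenFiber E x →L[ℝ] GenFiber E x)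

/-- The section `J v`. -/
def GenEndo.app (J : GenEndo E M) (v : GenField E M) : GenField E M := fun x ↦ J x (v x)

/-- The Nijenhuis operator
`N_J(v, w) = [Jv, Jw] - J[Jv, w] - J[v, Jw] + J²[v, w]` with respect to a bracket. -/
def nijenhuis (br : GenField E M → GenField E M → GenField E M) (J : GenEndo E M)
    (v w : GenField E M) : GenField E M := fun x ↦
  br (J.app v) (J.app w) x - J x (br (J.app v) w x) - J x (br v (J.app w) x)
    + J x (J x (br v w x))

/-- The Nijenhuis operator with respect to the bracket vanishes. -/
def NijenhuisIntegrable (br : GenField E M → GenField E M → GenField E M) (J : GenEndo E M) :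
    Prop :=
  ∀ v w : GenField E M, SmoothGenField v → SmoothGenField w → ∀ x, nijenhuis br J v w x = 0

/-- `v` is a smooth section of the `+1`-eigenbundle `V⁺` of `J`. -/
def IsPlusSection (J : GenEndo E M) (v : GenField E M) : Prop :=
  SmoothGenField v ∧ ∀ x, J x (v x) = v x

/-- `[·,·]_C`-integrability of `J`: the Courant bracket of two smooth sections of the
`+1`-eigenbundle takes its values in the `+1`-eigenbundle. -/
def CourantIntegrable (J : GenEndo E M) : Prop :=
  ∀ v w : GenField E M, IsPlusSection J v → IsPlusSection J w →
    ∀ x, J x (courant v w x) = courant v w x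

end Calculus

section Metric

variable (E : Type*) [NormedAddCommGroup E] [NormedSpace ℝ E]
  (M : Type*) [TopologicalSpace M] [ChartedSpace E M] [IsManifold 𝓘(ℝ, E) ∞ M]

/-- A pseudo-Riemannian metric (of arbitrary signature) on `M`. -/
structure PseudoMetric where
  /-- The bilinear form on each tangent space; it is also the map `TM → T*M`, `X ↦ g(X, ·)`. -/
  val (x : M) : TangentSpace 𝓘(ℝ, E) x →L[ℝ] TangentSpace 𝓘(ℝ, E) x →L[ℝ] ℝ
  symm (x : M) (u v : TangentSpace 𝓘(ℝ, E) x) : val x u v = val x v u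
  nondegenerate (x : M) (u : TangentSpace 𝓘(ℝ, E) x) (hu : ∀ v, val x u v = 0) : u = 0
  smooth : ContMDiff 𝓘(ℝ, E) (𝓘(ℝ, E).prod 𝓘(ℝ, E →L[ℝ] E →L[ℝ] ℝ)) ∞
    (fun x ↦ TotalSpace.mk' (E →L[ℝ] E →L[ℝ] ℝ) x (val x))

/-- A smooth differential `2`-form on `M`. -/
structure TwoForm where
  /-- The skew form on each tangent space; it is also the map `TM → T*M`, `X ↦ ι_X b`. -/
  val (x : M) : TangentSpace 𝓘(ℝ, E) x →L[ℝ] TangentSpace 𝓘(ℝ, E) x →L[ℝ] ℝ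
  skew (x : M) (u v : TangentSpace 𝓘(ℝ, E) x) : val x u v = -val x v u
  smooth : ContMDiff 𝓘(ℝ, E) (𝓘(ℝ, E).prod 𝓘(ℝ, E →L[ℝ] E →L[ℝ] ℝ)) ∞
    (fun x ↦ TotalSpace.mk' (E →L[ℝ] E →L[ℝ] ℝ) x (val x))

end Metric

section GenMetric

variable {E : Type*} [NormedAddCommGroup E] [NormedSpace ℝ E]
  {M : Type*} [TopologicalSpace M] [ChartedSpace E M] [IsManifold 𝓘(ℝ, E) ∞ M]

/-- The function `b(X, Y)`. -/
def TwoForm.eval (b : TwoForm E M) (X Y : VField E M) (x : M) : ℝ := b.val x (X x) (Y x)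

/-- `db = 0`, with `db(X, Y, Z)` the cyclic sum of `X(b(Y, Z)) - b([X, Y], Z)`. -/
def TwoForm.IsClosed (b : TwoForm E M) : Prop :=
  ∀ X Y Z : VField E M, SmoothVField X → SmoothVField Y → SmoothVField Z → ∀ x,
    dirDeriv X (b.eval Y Z) x + dirDeriv Y (b.eval Z X) x + dirDeriv Z (b.eval X Y) x
      - b.eval (lieBr X Y) Z x - b.eval (lieBr Y Z) X x - b.eval (lieBr Z X) Y x = 0

/-- `∇b = 0`, with `(∇_X b)(Y, Z) = X(b(Y, Z)) - b(∇_X Y, Z) - b(Y, ∇_X Z)`. -/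
def TwoForm.IsParallel (b : TwoForm E M) (nabla : VField E M → VField E M → VField E M) : Prop :=
  ∀ X Y Z : VField E M, SmoothVField X → SmoothVField Y → SmoothVField Z → ∀ x,
    dirDeriv X (b.eval Y Z) x - b.eval (nabla X Y) Z x - b.eval Y (nabla X Z) x = 0

/-- The endomorphism of `TM ⊕ T*M` given by `X + ξ ↦ X + ξ + β X`, for `β : TM → T*M`. -/
def shear (β : (x : M) → TangentSpace 𝓘(ℝ, E) x →L[ℝ] TangentSpace 𝓘(ℝ, E) x →L[ℝ] ℝ) :
    GenEndo E M := fun x ↦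
  (ContinuousLinearMap.fst ℝ _ _).prod
    (ContinuousLinearMap.snd ℝ _ _ + (β x).comp (ContinuousLinearMap.fst ℝ _ _))

/-- The endomorphism `X + ξ ↦ g⁻¹ξ + gX`. -/
def PseudoMetric.endo (g : PseudoMetric E M) : GenEndo E M := fun x ↦
  ((g.val x).inverse.comp (ContinuousLinearMap.snd ℝ _ _)).prod
    ((g.val x).comp (ContinuousLinearMap.fst ℝ _ _))

/-- The endomorphism `G` of `TM ⊕ T*M` induced by `(g, b)`; as a block matrix
`G = [[-g⁻¹b, g⁻¹], [g - b g⁻¹ b, b g⁻¹]]`, where `g` and `b` stand for `X ↦ g(X, ·)` and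
`X ↦ b(X, ·)`. Its `±1`-eigenbundles are `V^± = {X ± gX + bX}`. -/
def genMetric (g : PseudoMetric E M) (b : TwoForm E M) : GenEndo E M := fun x ↦
  (shear b.val x).comp ((g.endo x).comp (shear (fun y ↦ -b.val y) x))

/-- The lift `X⁺ = X + gX + bX` of a vector field to `V⁺`. -/
def liftPlus (g : PseudoMetric E M) (b : TwoForm E M) (X : VField E M) : GenField E M :=
  fun x ↦ (X x, g.val x (X x) + b.val x (X x))

/-- The lift `X⁻ = X - gX + bX` of a vector field to `V⁻`. -/
def liftMinus (g : PseudoMetric E M) (b : TwoForm E M) (X : VField E M) : GenField E M :=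
  fun x ↦ (X x, -g.val x (X x) + b.val x (X x))

/-- The affine connection `∇⁺_X Y = π([X⁻, Y⁺]_C)₊` induced by `(g, b)`, where
`(·)₊ = (1/2)(Id + G)` is the projection onto `V⁺` along `V⁻` and `π` is the projection to `TM`. -/
def nablaPlus [FiniteDimensional ℝ E] (g : PseudoMetric E M) (b : TwoForm E M)
    (X Y : VField E M) : VField E M := fun x ↦
  ((1 / 2 : ℝ) • (courant (liftMinus g b X) (liftPlus g b Y) x
    + genMetric g b x (courant (liftMinus g b X) (liftPlus g b Y) x))).1

/-- The condition `⟨∇̃_u v, w⟩ = ⟨∇̃_{Gu} v, Gw⟩` for all smooth sections `u` (with `v`, `w` given),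
where `∇̃` is the generalized connection induced by `∇⁺`. -/
def SymmCondition [FiniteDimensional ℝ E] (g : PseudoMetric E M) (b : TwoForm E M)
    (v w : GenField E M) : Prop :=
  ∀ u : GenField E M, SmoothGenField u → ∀ x,
    pairing (genConn (nablaPlus g b) u v x) (w x) =
      pairing (genConn (nablaPlus g b) ((genMetric g b).app u) v x) ((genMetric g b).app w x)

end GenMetric

end GenGeom

end

/-!
Shearing by `b` changes the Courant bracket only by `db`. Comparing the brackets of the sections
`X - gX` and `Y + gY` of the graphs of `±g`, one finds the Koszul formula
`2 g(∇⁺_X Y, Z) = K(X, Y, Z) + db(X, Y, Z)`, where `K(X, Y, Z)` is the expression that gives the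
Levi-Civita connection. Hence `∇⁺` is always metric, and it is torsion-free when `db = 0`.

(i) Since `∇⁺g = 0` and `∇⁺b = 0`, all three factors of `G = e^b ∘ (X + ξ ↦ g⁻¹ξ + gX) ∘ e^{-b}`
are parallel, and the Nijenhuis operator of a parallel endomorphism with respect to the bracket of
a torsion-free connection vanishes.

(ii) The failure of `[X⁺, Y⁺]_C` to lie in `V⁺` is the one-form
`Z ↦ g(∇⁺_Z X, Y) - g(X, ∇⁺_Z Y)`. For `u = Z + bZ` the vector part of `Gu` is zero, so the
symmetry condition on the pair makes both terms vanish.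
-/

noncomputable section

namespace GenGeom

section Differentiability

variable {E : Type*} [NormedAddCommGroup E] [NormedSpace ℝ E]
  {M : Type*} [TopologicalSpace M] [ChartedSpace E M]
  {x : M} {X Y Z : VField E M} {ξ η : OneForm E M} {f h : M → ℝ}

theorem evalForm_add_right (ξ : OneForm E M) (X Y : VField E M) :
    evalForm ξ (X + Y) = evalForm ξ X + evalForm ξ Y :=
  funext fun y ↦ map_add (ξ y) (X y) (Y y)

theorem evalForm_smul_right (ξ : OneForm E M) (f : M → ℝ) (X : VField E M) :
    evalForm ξ (f • X) = f * evalForm ξ X :=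
  funext fun y ↦ map_smul (ξ y) (f y) (X y)

theorem dirDeriv_add (hf : MDiffAt f x) (hh : MDiffAt h x) :
    dirDeriv X (f + h) x = dirDeriv X f x + dirDeriv X h x := by
  simp [dirDeriv, mvfderiv_add hf hh]

theorem dirDeriv_neg (X : VField E M) (f : M → ℝ) (x : M) :
    dirDeriv X (-f) x = -dirDeriv X f x := by
  simp [dirDeriv, mvfderiv_neg]

theorem dirDeriv_mul (hf : MDiffAt f x) (hh : MDiffAt h x) :
    dirDeriv X (f * h) x = f x * dirDeriv X h x + h x * dirDeriv X f x := by
  simp [dirDeriv, mvfderiv_mul hf hh]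

theorem lieBr_swap (X Y : VField E M) (x : M) : lieBr X Y x = -lieBr Y X x :=
  VectorField.mlieBracket_swap_apply

variable [IsManifold 𝓘(ℝ, E) ∞ M]

/-- Differentiability of a one-form at a point, as a section of the cotangent bundle. -/
def OneFormDiffAt (ξ : OneForm E M) (x : M) : Prop :=
  MDifferentiableAt 𝓘(ℝ, E) (𝓘(ℝ, E).prod 𝓘(ℝ, E →L[ℝ] ℝ))
    (fun y ↦ TotalSpace.mk' (E →L[ℝ] ℝ) y (ξ y)) x

theorem SmoothVField.mdiffAt (hX : SmoothVField X) (x : M) : MDiffAt (T% X) x :=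
  (hX x).mdifferentiableAt (by simp)

theorem SmoothOneForm.diffAt (hξ : SmoothOneForm ξ) (x : M) : OneFormDiffAt ξ x :=
  (hξ x).mdifferentiableAt (by simp)

theorem SmoothOneForm.add (hξ : SmoothOneForm ξ) (hη : SmoothOneForm η) :
    SmoothOneForm (ξ + η) :=
  ContMDiff.add_section hξ hη

theorem OneFormDiffAt.add (hξ : OneFormDiffAt ξ x) (hη : OneFormDiffAt η x) :
    OneFormDiffAt (ξ + η) x :=
  mdifferentiableAt_add_section hξ hη

theorem OneFormDiffAt.evalForm (hξ : OneFormDiffAt ξ x) (hX : MDiffAt (T% X) x) :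
    MDiffAt (evalForm ξ X) x := by
  have h := MDifferentiableAt.clm_bundle_apply (E₂ := Bundle.Trivial M ℝ) (F₂ := ℝ)
    (b := fun y : M ↦ y) hξ hX
  exact ((mdifferentiableAt_totalSpace _ _).1 h).2

theorem tensorialAt_dirDeriv (h : M → ℝ) (x : M) :
    TensorialAt 𝓘(ℝ, E) E (fun Z : VField E M ↦ dirDeriv Z h x) x where
  smul _ _ := by simp [dirDeriv]
  add _ _ := by simp [dirDeriv]

/-- `D` is a derivation along `X` at `x`: it is additive and satisfies the Leibniz rule
`D (f Z) = X(f) Z + f D Z` on functions and vector fields that are differentiable at `x`.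
Both `[X, ·]` and `∇_X` are of this kind. -/
structure IsDerivationAt (X : VField E M) (D : VField E M → VField E M) (x : M) : Prop where
  add {Y Z : VField E M} : MDiffAt (T% Y) x → MDiffAt (T% Z) x → D (Y + Z) x = D Y x + D Z x
  smul {f : M → ℝ} {Z : VField E M} : MDiffAt f x → MDiffAt (T% Z) x →
    D (f • Z) x = dirDeriv X f x • Z x + f x • D Z x

theorem isDerivationAt_lieBr [CompleteSpace E] (X : VField E M) (x : M) :
    IsDerivationAt X (lieBr X) x where
  add hY hZ := VectorField.mlieBracket_add_right hY hZ
  smul hf hZ := VectorField.mlieBracket_smul_right hf hZ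

theorem IsDerivationAt.apply_zero {D : VField E M → VField E M} (hD : IsDerivationAt X D x) :
    D 0 x = 0 := by
  have h0 : MDiffAt (T% (0 : VField E M)) x :=
    (Bundle.contMDiff_zeroSection (n := 1) ℝ (TangentSpace 𝓘(ℝ, E))).mdifferentiable
      one_ne_zero x
  simpa using hD.add h0 h0

theorem IsDerivationAt.tensorialAt_dual {D : VField E M → VField E M}
    (hD : IsDerivationAt X D x) (hη : OneFormDiffAt η x) :
    TensorialAt 𝓘(ℝ, E) E (fun Z ↦ dirDeriv X (evalForm η Z) x - η x (D Z x)) x where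
  smul hf hZ := by
    rw [evalForm_smul_right, dirDeriv_mul hf (hη.evalForm hZ), hD.smul hf hZ]
    simp only [evalForm, map_add, map_smul, smul_eq_mul]
    ring
  add hY hZ := by
    rw [evalForm_add_right, dirDeriv_add (hη.evalForm hY) (hη.evalForm hZ), hD.add hY hZ, map_add]
    ring

theorem exists_mdiffAt_eq (x : M) (u : TangentSpace 𝓘(ℝ, E) x) :
    ∃ X : VField E M, MDiffAt (T% X) x ∧ X x = u :=
  ⟨FiberBundle.extend E u, FiberBundle.mdifferentiableAt_extend 𝓘(ℝ, E) E u,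
    FiberBundle.extend_apply_self E u⟩

variable [FiniteDimensional ℝ E] [T2Space M]

theorem exists_smoothVField_eq (x : M) (u : TangentSpace 𝓘(ℝ, E) x) :
    ∃ X : VField E M, SmoothVField X ∧ X x = u := by
  obtain ⟨s, hs, hsX⟩ := FiberBundle.exists_contMDiffOn_extend (k := ∞) 𝓘(ℝ, E) E u
  obtain ⟨ψ, hψ⟩ := ((SmoothBumpFunction.nhds_basis_tsupport
    (I := 𝓘(ℝ, E)) x).mem_iff).1 (interior_mem_nhds.2 hs)
  refine ⟨fun y ↦ ψ y • FiberBundle.extend E u y, ?_, by simp⟩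
  exact ContMDiffOn.smul_section_of_tsupport (u := interior s) ψ.contMDiff.contMDiffOn
    isOpen_interior hψ.2 (hsX.mono interior_subset)

theorem covector_ext_of_smooth {α β : TangentSpace 𝓘(ℝ, E) x →L[ℝ] ℝ}
    (h : ∀ Z, SmoothVField Z → α (Z x) = β (Z x)) : α = β := by
  ext v
  obtain ⟨Z, hZ, rfl⟩ := exists_smoothVField_eq x v
  exact h Z hZ

end Differentiability

section Courant

variable {E : Type*} [NormedAddCommGroup E] [NormedSpace ℝ E] [FiniteDimensional ℝ E]
  {M : Type*} [TopologicalSpace M] [ChartedSpace E M] [IsManifold 𝓘(ℝ, E) ∞ M]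
  {x : M} {X Y Z : VField E M} {ξ η : OneForm E M} {v w : GenField E M}

theorem formOf_apply {Φ : VField E M → M → ℝ} (h : TensorialAt 𝓘(ℝ, E) E (fun Z ↦ Φ Z x) x)
    (hZ : MDiffAt (T% Z) x) : formOf Φ x (Z x) = Φ Z x := by
  rw [formOf, dif_pos h]
  exact TensorialAt.mkHom_apply h hZ

theorem lieDerivForm_apply (hη : OneFormDiffAt η x) (hZ : MDiffAt (T% Z) x) :
    lieDerivForm X η x (Z x) = dirDeriv X (evalForm η Z) x - η x (lieBr X Z x) :=
  have : CompleteSpace E := FiniteDimensional.complete ℝ E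
  formOf_apply ((isDerivationAt_lieBr X x).tensorialAt_dual hη) hZ

theorem contractD_apply (hξ : OneFormDiffAt ξ x) (hZ : MDiffAt (T% Z) x) :
    contractD Y ξ x (Z x) =
      dirDeriv Y (evalForm ξ Z) x - dirDeriv Z (evalForm ξ Y) x - ξ x (lieBr Y Z x) := by
  have : CompleteSpace E := FiniteDimensional.complete ℝ E
  have hL := (isDerivationAt_lieBr Y x).tensorialAt_dual hξ
  have hd := tensorialAt_dirDeriv (E := E) (evalForm ξ Y) x
  refine formOf_apply ⟨fun hf hW ↦ ?_, fun hV hW ↦ ?_⟩ hZ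
  · have h₁ := hL.smul hf hW
    have h₂ := hd.smul hf hW
    simp only [smul_eq_mul] at h₁ h₂ ⊢
    linear_combination h₁ - h₂
  · linear_combination hL.add hV hW - hd.add hV hW

theorem fst_courant (v w : GenField E M) (x : M) :
    (courant v w x).1 = lieBr (fun y ↦ (v y).1) (fun y ↦ (w y).1) x := by
  simp only [courant, dorfman, Prod.smul_fst, Prod.fst_sub]
  rw [lieBr_swap (fun y ↦ (w y).1)]
  module

theorem snd_courant_apply (hξ : OneFormDiffAt (fun y ↦ (v y).2) x)
    (hη : OneFormDiffAt (fun y ↦ (w y).2) x) (hZ : MDiffAt (T% Z) x) :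
    (courant v w x).2 (Z x) =
      dirDeriv (fun y ↦ (v y).1) (evalForm (fun y ↦ (w y).2) Z) x
      - (w x).2 (lieBr (fun y ↦ (v y).1) Z x)
      - dirDeriv (fun y ↦ (w y).1) (evalForm (fun y ↦ (v y).2) Z) x
      + (v x).2 (lieBr (fun y ↦ (w y).1) Z x)
      - 1 / 2 * (dirDeriv Z (evalForm (fun y ↦ (w y).2) (fun y ↦ (v y).1)) x
        - dirDeriv Z (evalForm (fun y ↦ (v y).2) (fun y ↦ (w y).1)) x) := by
  simp only [courant, dorfman, Prod.smul_snd, Prod.snd_sub, smul_apply, sub_apply, smul_eq_mul,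
    lieDerivForm_apply hη hZ, lieDerivForm_apply hξ hZ, contractD_apply hη hZ,
    contractD_apply hξ hZ]
  ring

end Courant

section Bilinear

variable {E : Type*} [NormedAddCommGroup E] [NormedSpace ℝ E]
  {M : Type*} [TopologicalSpace M] [ChartedSpace E M]

variable (E M) in
/-- (Not necessarily smooth) fields of bilinear forms on `M`, regarded as maps `TM → T*M`. -/
abbrev BilinField : Type _ :=
  (x : M) → TangentSpace 𝓘(ℝ, E) x →L[ℝ] TangentSpace 𝓘(ℝ, E) x →L[ℝ] ℝ

/-- The one-form `β(X, ·)`. -/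
def flat (β : BilinField E M) (X : VField E M) : OneForm E M := fun x ↦ β x (X x)

/-- The function `β(X, Y)`. -/
def evalBilin (β : BilinField E M) (X Y : VField E M) (x : M) : ℝ := β x (X x) (Y x)

/-- The section `X + βX` of the graph of `β : TM → T*M`; for `β = ±g + b` these are the sections
of the eigenbundles `V^±`. -/
def graph (β : BilinField E M) (X : VField E M) : GenField E M := fun x ↦ (X x, flat β X x)

variable [IsManifold 𝓘(ℝ, E) ∞ M] {β γ : BilinField E M} {x : M} {X Y : VField E M}

/-- Smoothness of a field of bilinear forms, as a section of `Hom(TM, T*M)`. -/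
def SmoothBilin (β : BilinField E M) : Prop :=
  ContMDiff 𝓘(ℝ, E) (𝓘(ℝ, E).prod 𝓘(ℝ, E →L[ℝ] E →L[ℝ] ℝ)) ∞
    (fun x ↦ TotalSpace.mk' (E →L[ℝ] E →L[ℝ] ℝ) x (β x))

theorem PseudoMetric.smoothBilin (g : PseudoMetric E M) : SmoothBilin g.val := g.smooth

theorem TwoForm.smoothBilin (b : TwoForm E M) : SmoothBilin b.val := b.smooth

namespace SmoothBilin

theorem add (hβ : SmoothBilin β) (hγ : SmoothBilin γ) : SmoothBilin (β + γ) :=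
  ContMDiff.add_section hβ hγ

theorem neg (hβ : SmoothBilin β) : SmoothBilin (-β) :=
  ContMDiff.neg_section hβ

theorem flat (hβ : SmoothBilin β) (hX : SmoothVField X) : SmoothOneForm (flat β X) :=
  ContMDiff.clm_bundle_apply (b := fun y : M ↦ y) hβ hX

theorem flat_diffAt (hβ : SmoothBilin β) (hX : MDiffAt (T% X) x) :
    OneFormDiffAt (GenGeom.flat β X) x :=
  MDifferentiableAt.clm_bundle_apply (b := fun y : M ↦ y)
    ((hβ x).mdifferentiableAt (by simp)) hX

theorem evalBilin_mdiffAt (hβ : SmoothBilin β) (hX : MDiffAt (T% X) x)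
    (hY : MDiffAt (T% Y) x) : MDiffAt (evalBilin β X Y) x :=
  (hβ.flat_diffAt hX).evalForm hY

theorem graph (hβ : SmoothBilin β) (hX : SmoothVField X) : SmoothGenField (graph β X) :=
  ⟨hX, hβ.flat hX⟩

end SmoothBilin

theorem liftPlus_eq_graph (g : PseudoMetric E M) (b : TwoForm E M) (X : VField E M) :
    liftPlus g b X = graph (g.val + b.val) X :=
  rfl

theorem liftPlus_eq_shear_app (g : PseudoMetric E M) (b : TwoForm E M) (X : VField E M) :
    liftPlus g b X = (shear b.val).app (graph g.val X) :=
  rfl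

theorem liftMinus_eq_shear_app (g : PseudoMetric E M) (b : TwoForm E M) (X : VField E M) :
    liftMinus g b X = (shear b.val).app (graph (-g.val) X) :=
  rfl

end Bilinear

section ExteriorDerivative

variable {E : Type*} [NormedAddCommGroup E] [NormedSpace ℝ E]
  {M : Type*} [TopologicalSpace M] [ChartedSpace E M] [IsManifold 𝓘(ℝ, E) ∞ M]

/-- The function `db(X, Y, Z)`, so that `b.IsClosed` says that it vanishes on smooth fields. -/
def TwoForm.extDeriv (b : TwoForm E M) (X Y Z : VField E M) (x : M) : ℝ :=
  dirDeriv X (b.eval Y Z) x + dirDeriv Y (b.eval Z X) x + dirDeriv Z (b.eval X Y) x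
    - b.eval (lieBr X Y) Z x - b.eval (lieBr Y Z) X x - b.eval (lieBr Z X) Y x

theorem TwoForm.eval_swap (b : TwoForm E M) (X Y : VField E M) : b.eval X Y = -b.eval Y X :=
  funext fun x ↦ b.skew x _ _

theorem TwoForm.eval_lieBr_swap (b : TwoForm E M) (X Y Z : VField E M) (x : M) :
    b.eval (lieBr X Y) Z x = -b.eval (lieBr Y X) Z x := by
  simp only [TwoForm.eval, lieBr_swap X Y, map_neg, neg_apply]

theorem TwoForm.extDeriv_swap_right (b : TwoForm E M) (X Y Z : VField E M) (x : M) :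
    b.extDeriv X Z Y x = -b.extDeriv X Y Z x := by
  simp only [TwoForm.extDeriv]
  rw [b.eval_swap Z Y, b.eval_swap Y X, b.eval_swap X Z, b.eval_lieBr_swap X Z,
    b.eval_lieBr_swap Z Y, b.eval_lieBr_swap Y X]
  simp only [dirDeriv_neg]
  ring

variable [FiniteDimensional ℝ E] {x : M} {X Y Z : VField E M} {v w : GenField E M}

theorem snd_courant_shear_apply (b : TwoForm E M)
    (hX : MDiffAt (T% (fun y ↦ (v y).1)) x) (hξ : OneFormDiffAt (fun y ↦ (v y).2) x)
    (hY : MDiffAt (T% (fun y ↦ (w y).1)) x) (hη : OneFormDiffAt (fun y ↦ (w y).2) x)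
    (hZ : MDiffAt (T% Z) x) :
    (courant ((shear b.val).app v) ((shear b.val).app w) x).2 (Z x) =
      (courant v w x).2 (Z x) + b.eval (lieBr (fun y ↦ (v y).1) (fun y ↦ (w y).1)) Z x
        + b.extDeriv (fun y ↦ (v y).1) (fun y ↦ (w y).1) Z x := by
  set X : VField E M := fun y ↦ (v y).1
  set Y : VField E M := fun y ↦ (w y).1
  set ξ : OneForm E M := fun y ↦ (v y).2
  set η : OneForm E M := fun y ↦ (w y).2
  have hbX := b.smoothBilin.flat_diffAt hX
  have hbY := b.smoothBilin.flat_diffAt hY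
  have dirDeriv_shear (W : VField E M) {ζ : OneForm E M} {U V : VField E M}
      (hζ : OneFormDiffAt ζ x) (hU : MDiffAt (T% U) x) (hV : MDiffAt (T% V) x) :
      dirDeriv W (evalForm (ζ + flat b.val U) V) x =
        dirDeriv W (evalForm ζ V) x + dirDeriv W (b.eval U V) x :=
    dirDeriv_add (hζ.evalForm hV) (b.smoothBilin.evalBilin_mdiffAt hU hV)
  have hshear : (courant ((shear b.val).app v) ((shear b.val).app w) x).2 (Z x) =
      dirDeriv X (evalForm (η + flat b.val Y) Z) x
      - (η x (lieBr X Z x) + b.eval Y (lieBr X Z) x)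
      - dirDeriv Y (evalForm (ξ + flat b.val X) Z) x
      + (ξ x (lieBr Y Z x) + b.eval X (lieBr Y Z) x)
      - 1 / 2 * (dirDeriv Z (evalForm (η + flat b.val Y) X) x
        - dirDeriv Z (evalForm (ξ + flat b.val X) Y) x) :=
    snd_courant_apply (hξ.add hbX) (hη.add hbY) hZ
  rw [hshear, dirDeriv_shear X hη hY hZ, dirDeriv_shear Y hξ hX hZ, dirDeriv_shear Z hη hY hX,
    dirDeriv_shear Z hξ hX hY, snd_courant_apply hξ hη hZ, TwoForm.extDeriv, b.eval_swap Y X,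
    b.eval_swap Z X, b.eval_swap Y (lieBr X Z), b.eval_swap X (lieBr Y Z),
    b.eval_lieBr_swap Z X]
  simp only [dirDeriv_neg, Pi.neg_apply]
  ring

theorem snd_courant_shear_graph_apply (b : TwoForm E M) {α β : BilinField E M}
    (hα : SmoothBilin α) (hβ : SmoothBilin β)
    (hX : MDiffAt (T% X) x) (hY : MDiffAt (T% Y) x) (hZ : MDiffAt (T% Z) x) :
    (courant ((shear b.val).app (graph α X)) ((shear b.val).app (graph β Y)) x).2 (Z x) =
      dirDeriv X (evalBilin β Y Z) x - evalBilin β Y (lieBr X Z) x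
      - dirDeriv Y (evalBilin α X Z) x + evalBilin α X (lieBr Y Z) x
      - 1 / 2 * (dirDeriv Z (evalBilin β Y X) x - dirDeriv Z (evalBilin α X Y) x)
      + b.eval (lieBr X Y) Z x + b.extDeriv X Y Z x := by
  have hαX := hα.flat_diffAt hX
  have hβY := hβ.flat_diffAt hY
  rw [snd_courant_shear_apply (v := graph α X) (w := graph β Y) b hX hαX hY hβY hZ,
    snd_courant_apply (v := graph α X) (w := graph β Y) hαX hβY hZ]
  rfl

end ExteriorDerivative

section Connection

variable {E : Type*} [NormedAddCommGroup E] [NormedSpace ℝ E]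
  {M : Type*} [TopologicalSpace M] [ChartedSpace E M] [IsManifold 𝓘(ℝ, E) ∞ M]
  {nabla : VField E M → VField E M → VField E M} {β γ : BilinField E M}
  {x : M} {X Y Z : VField E M} {ξ η : OneForm E M} {v w : GenField E M}

/-- The Leibniz rule for an operation `(X, Y) ↦ ∇_X Y`. It is imposed on fields that are merely
differentiable at a point, because `formOf` tests tensoriality on such fields. -/
def IsLeibniz (nabla : VField E M → VField E M → VField E M) : Prop :=
  ∀ (X : VField E M) (x : M), MDiffAt (T% X) x → IsDerivationAt X (nabla X) x

/-- Vanishing torsion of an operation `(X, Y) ↦ ∇_X Y`, on smooth vector fields. -/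
def IsTorsionFree (nabla : VField E M → VField E M → VField E M) : Prop :=
  ∀ X Y : VField E M, SmoothVField X → SmoothVField Y → ∀ x,
    lieBr X Y x = nabla X Y x - nabla Y X x

/-- `∇β = 0` for a field of bilinear forms, tested on smooth vector fields. -/
def BilinField.IsParallel (β : BilinField E M)
    (nabla : VField E M → VField E M → VField E M) : Prop :=
  ∀ X Y Z : VField E M, SmoothVField X → SmoothVField Y → SmoothVField Z → ∀ x,
    dirDeriv X (evalBilin β Y Z) x =
      evalBilin β (nabla X Y) Z x + evalBilin β Y (nabla X Z) x

/-- `∇g = 0`, tested on all vector fields that are differentiable at the point in question. -/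
def PseudoMetric.IsCompatible (g : PseudoMetric E M)
    (nabla : VField E M → VField E M → VField E M) : Prop :=
  ∀ (X Y Z : VField E M) (x : M), MDiffAt (T% X) x → MDiffAt (T% Y) x → MDiffAt (T% Z) x →
    dirDeriv X (evalBilin g.val Y Z) x =
      evalBilin g.val (nabla X Y) Z x + evalBilin g.val Y (nabla X Z) x

theorem TwoForm.IsParallel.isParallel_val {b : TwoForm E M} (hb : b.IsParallel nabla) :
    BilinField.IsParallel b.val nabla := fun X Y Z hX hY hZ x ↦ by
  have h : dirDeriv X (evalBilin b.val Y Z) x - evalBilin b.val (nabla X Y) Z x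
      - evalBilin b.val Y (nabla X Z) x = 0 := hb X Y Z hX hY hZ x
  linarith

theorem PseudoMetric.IsCompatible.isParallel_val {g : PseudoMetric E M}
    (hg : g.IsCompatible nabla) : BilinField.IsParallel g.val nabla :=
  fun X Y Z hX hY hZ x ↦ hg X Y Z x (hX.mdiffAt x) (hY.mdiffAt x) (hZ.mdiffAt x)

theorem BilinField.IsParallel.neg (hβ : β.IsParallel nabla) : BilinField.IsParallel (-β) nabla :=
  fun X Y Z hX hY hZ x ↦ by
    have h : evalBilin (-β) Y Z = -evalBilin β Y Z := rfl
    rw [h, dirDeriv_neg, hβ X Y Z hX hY hZ x]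
    simp only [evalBilin, Pi.neg_apply, neg_apply]
    ring

theorem BilinField.IsParallel.add (hβ : β.IsParallel nabla) (hγ : γ.IsParallel nabla)
    (hβs : SmoothBilin β) (hγs : SmoothBilin γ) : BilinField.IsParallel (β + γ) nabla :=
  fun X Y Z hX hY hZ x ↦ by
    have h : evalBilin (β + γ) Y Z = evalBilin β Y Z + evalBilin γ Y Z := rfl
    rw [h, dirDeriv_add (hβs.evalBilin_mdiffAt (hY.mdiffAt x) (hZ.mdiffAt x))
      (hγs.evalBilin_mdiffAt (hY.mdiffAt x) (hZ.mdiffAt x)), hβ X Y Z hX hY hZ x,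
      hγ X Y Z hX hY hZ x]
    simp only [evalBilin, Pi.add_apply, add_apply]
    ring

theorem IsTorsionFree.apply_zero_left (ht : IsTorsionFree nabla) (hL : IsLeibniz nabla)
    (hX : SmoothVField X) (x : M) : nabla 0 X x = 0 := by
  have h : lieBr 0 X x = nabla 0 X x - nabla X 0 x :=
    ht 0 X (Bundle.contMDiff_zeroSection ℝ (TangentSpace 𝓘(ℝ, E))) hX x
  rwa [(hL X x (hX.mdiffAt x)).apply_zero, lieBr, VectorField.mlieBracket_zero_left, sub_zero,
    eq_comm] at h

variable [FiniteDimensional ℝ E]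

theorem covForm_apply (hL : IsLeibniz nabla) (hX : MDiffAt (T% X) x) (hη : OneFormDiffAt η x)
    (hZ : MDiffAt (T% Z) x) :
    covForm nabla X η x (Z x) = dirDeriv X (evalForm η Z) x - η x (nabla X Z x) :=
  formOf_apply ((hL X x hX).tensorialAt_dual hη) hZ

theorem IsTorsionFree.connBracket_eq (ht : IsTorsionFree nabla) (hv : SmoothGenField v)
    (hw : SmoothGenField w) (x : M) :
    connBracket nabla v w x = genConn nabla v w x - genConn nabla w v x :=
  Prod.ext (ht _ _ hv.1 hw.1 x) rfl

section Extensionality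

variable [T2Space M]

theorem covForm_add (hL : IsLeibniz nabla) (hX : MDiffAt (T% X) x) (hξ : OneFormDiffAt ξ x)
    (hη : OneFormDiffAt η x) :
    covForm nabla X (ξ + η) x = covForm nabla X ξ x + covForm nabla X η x := by
  refine covector_ext_of_smooth fun Z hZ ↦ ?_
  have hZx := hZ.mdiffAt x
  have h : evalForm (ξ + η) Z = evalForm ξ Z + evalForm η Z := rfl
  rw [add_apply, covForm_apply hL hX hξ hZx, covForm_apply hL hX hη hZx,
    covForm_apply hL hX (hξ.add hη) hZx, h, dirDeriv_add (hξ.evalForm hZx) (hη.evalForm hZx),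
    Pi.add_apply, add_apply]
  ring

theorem covForm_flat (hL : IsLeibniz nabla) (hβs : SmoothBilin β)
    (hβ : β.IsParallel nabla) (hX : SmoothVField X) (hY : SmoothVField Y) (x : M) :
    covForm nabla X (flat β Y) x = flat β (nabla X Y) x := by
  refine covector_ext_of_smooth fun Z hZ ↦ ?_
  rw [covForm_apply hL (hX.mdiffAt x) (hβs.flat_diffAt (hY.mdiffAt x)) (hZ.mdiffAt x)]
  exact sub_eq_of_eq_add (hβ X Y Z hX hY hZ x)

theorem genConn_graph (hL : IsLeibniz nabla) (hβs : SmoothBilin β)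
    (hβ : β.IsParallel nabla) (hv : SmoothVField (fun y ↦ (v y).1)) (hY : SmoothVField Y)
    (x : M) :
    genConn nabla v (graph β Y) x = graph β (nabla (fun y ↦ (v y).1) Y) x :=
  Prod.ext rfl (covForm_flat hL hβs hβ hv hY x)

end Extensionality

end Connection

section ParallelEndomorphism

variable {E : Type*} [NormedAddCommGroup E] [NormedSpace ℝ E] [FiniteDimensional ℝ E]
  {M : Type*} [TopologicalSpace M] [ChartedSpace E M] [IsManifold 𝓘(ℝ, E) ∞ M]
  {nabla : VField E M → VField E M → VField E M} {J K : GenEndo E M} {β : BilinField E M}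
  {v w : GenField E M}

/-- `J` preserves smooth sections and is parallel for the generalized connection `∇̃` that `∇`
induces on `TM ⊕ T*M`. -/
structure GenEndo.IsParallel (J : GenEndo E M) (nabla : VField E M → VField E M → VField E M) :
    Prop where
  smooth_app {v : GenField E M} : SmoothGenField v → SmoothGenField (J.app v)
  genConn_app {v w : GenField E M} : SmoothGenField v → SmoothGenField w → ∀ x,
    genConn nabla v (J.app w) x = J x (genConn nabla v w x)

theorem GenEndo.IsParallel.comp (hJ : J.IsParallel nabla) (hK : K.IsParallel nabla) :
    GenEndo.IsParallel (fun x ↦ (J x).comp (K x)) nabla where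
  smooth_app hv := hJ.smooth_app (hK.smooth_app hv)
  genConn_app hv hw x := (hJ.genConn_app hv (hK.smooth_app hw) x).trans
    (congrArg (J x) (hK.genConn_app hv hw x))

/-- Both terms of `[·, ·]_∇ = ∇̃_v w - ∇̃_w v` commute with `J` in their second argument, so the
eight terms of the Nijenhuis operator cancel in pairs. -/
theorem GenEndo.IsParallel.nijenhuisIntegrable (hJ : J.IsParallel nabla)
    (ht : IsTorsionFree nabla) : NijenhuisIntegrable (connBracket nabla) J := by
  intro v w hv hw x
  have hJv := hJ.smooth_app hv
  have hJw := hJ.smooth_app hw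
  rw [nijenhuis, ht.connBracket_eq hJv hJw, ht.connBracket_eq hJv hw, ht.connBracket_eq hv hJw,
    ht.connBracket_eq hv hw, hJ.genConn_app hJv hw, hJ.genConn_app hJw hv,
    hJ.genConn_app hw hv, hJ.genConn_app hv hw]
  have map_sub (a c : GenFiber E x) : J x (a - c) = J x a - J x c :=
    ContinuousLinearMap.map_sub _ a c
  simp only [map_sub]
  abel

theorem isParallel_shear [T2Space M] (hL : IsLeibniz nabla) (hβs : SmoothBilin β)
    (hβ : β.IsParallel nabla) : (shear β).IsParallel nabla where
  smooth_app hv := ⟨hv.1, hv.2.add (hβs.flat hv.1)⟩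
  genConn_app {v w} hv hw x := by
    refine Prod.ext rfl ?_
    have hβw := hβs.flat_diffAt (hw.1.mdiffAt x)
    exact (covForm_add hL (hv.1.mdiffAt x) (hw.2.diffAt x) hβw).trans
      (congrArg _ (covForm_flat hL hβs hβ hv.1 hw.1 x))

end ParallelEndomorphism

section Metric

theorem isInvertible_of_nondegenerate {E : Type*} [NormedAddCommGroup E] [NormedSpace ℝ E]
    [FiniteDimensional ℝ E] (β : E →L[ℝ] E →L[ℝ] ℝ) (hβ : ∀ u, (∀ v, β u v = 0) → u = 0) :
    β.IsInvertible := by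
  have hinj : Function.Injective (β : E →ₗ[ℝ] E →L[ℝ] ℝ) :=
    (injective_iff_map_eq_zero _).2 fun u hu ↦ hβ u fun v ↦ by
      simpa using congrArg (fun φ : E →L[ℝ] ℝ ↦ φ v) hu
  have hrank : Module.finrank ℝ E = Module.finrank ℝ (E →L[ℝ] ℝ) := by
    rw [← (LinearMap.toContinuousLinearMap : (E →ₗ[ℝ] ℝ) ≃ₗ[ℝ] E →L[ℝ] ℝ).finrank_eq]
    exact Subspace.dual_finrank_eq.symm
  exact ⟨(LinearEquiv.ofInjectiveOfFinrankEq _ hinj hrank).toContinuousLinearEquiv,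
    ContinuousLinearMap.ext fun _ ↦ rfl⟩

variable {E : Type*} [NormedAddCommGroup E] [NormedSpace ℝ E]
  {M : Type*} [TopologicalSpace M] [ChartedSpace E M] [IsManifold 𝓘(ℝ, E) ∞ M]
  {nabla : VField E M → VField E M → VField E M} {x : M} {X Y Z : VField E M} {ξ : OneForm E M}

namespace PseudoMetric

variable (g : PseudoMetric E M)

theorem evalBilin_comm (X Y : VField E M) : evalBilin g.val X Y = evalBilin g.val Y X :=
  funext fun x ↦ g.symm x _ _

theorem ext_of_mdiffAt {u u' : TangentSpace 𝓘(ℝ, E) x}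
    (h : ∀ Z : VField E M, MDiffAt (T% Z) x → g.val x u (Z x) = g.val x u' (Z x)) : u = u' := by
  refine sub_eq_zero.1 (g.nondegenerate x _ fun w ↦ ?_)
  obtain ⟨Z, hZ, rfl⟩ := exists_mdiffAt_eq x w
  rw [map_sub, sub_apply, h Z hZ, sub_self]

theorem ext_of_smooth [FiniteDimensional ℝ E] [T2Space M] {u u' : TangentSpace 𝓘(ℝ, E) x}
    (h : ∀ Z : VField E M, SmoothVField Z → g.val x u (Z x) = g.val x u' (Z x)) : u = u' := by
  refine sub_eq_zero.1 (g.nondegenerate x _ fun w ↦ ?_)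
  obtain ⟨Z, hZ, rfl⟩ := exists_smoothVField_eq x w
  rw [map_sub, sub_apply, h Z hZ, sub_self]

variable {g} in
/-- By nondegeneracy, `∇_X Y` is determined by `g(∇_X Y, Z) = X(g(Y, Z)) - g(Y, ∇_X Z)`, whose
right-hand side is a derivation in `Y`. -/
theorem IsCompatible.isLeibniz (hg : g.IsCompatible nabla) : IsLeibniz nabla := by
  intro X x hX
  refine ⟨fun {Y Y'} hY hY' ↦ g.ext_of_mdiffAt fun Z hZ ↦ ?_,
    fun {f Y} hf hY ↦ g.ext_of_mdiffAt fun Z hZ ↦ ?_⟩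
  · have h := hg X (Y + Y') Z x hX (mdifferentiableAt_add_section hY hY') hZ
    have hsplit : evalBilin g.val (Y + Y') Z = evalBilin g.val Y Z + evalBilin g.val Y' Z := by
      ext y
      simp only [evalBilin, Pi.add_apply, map_add, add_apply]
    rw [hsplit, dirDeriv_add (g.smoothBilin.evalBilin_mdiffAt hY hZ)
      (g.smoothBilin.evalBilin_mdiffAt hY' hZ), hg X Y Z x hX hY hZ, hg X Y' Z x hX hY' hZ] at h
    simp only [evalBilin, Pi.add_apply, map_add, add_apply] at h ⊢
    linarith
  · have h := hg X (f • Y) Z x hX (hf.smul_section hY) hZ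
    have hsplit : evalBilin g.val (f • Y) Z = f * evalBilin g.val Y Z := by
      ext y
      simp only [evalBilin, Pi.smul_apply', Pi.mul_apply, map_smul, smul_apply, smul_eq_mul]
    rw [hsplit, dirDeriv_mul hf (g.smoothBilin.evalBilin_mdiffAt hY hZ),
      hg X Y Z x hX hY hZ] at h
    simp only [evalBilin, Pi.smul_apply', map_add, map_smul, add_apply, smul_apply,
      smul_eq_mul] at h ⊢
    linarith

variable [FiniteDimensional ℝ E]

theorem isInvertible (x : M) : (g.val x).IsInvertible :=
  isInvertible_of_nondegenerate (E := E) (g.val x) (g.nondegenerate x)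

theorem val_inverse (α : TangentSpace 𝓘(ℝ, E) x →L[ℝ] ℝ) :
    g.val x ((g.val x).inverse α) = α :=
  (g.isInvertible x).self_apply_inverse α

theorem inverse_val (u : TangentSpace 𝓘(ℝ, E) x) : (g.val x).inverse (g.val x u) = u :=
  (g.isInvertible x).inverse_apply_self u

theorem smooth_inverse (hξ : SmoothOneForm ξ) :
    SmoothVField (fun y ↦ (g.val y).inverse (ξ y)) := by
  have : CompleteSpace E := FiniteDimensional.complete ℝ E
  intro x
  let tangent := fun y : M ↦ TangentSpace 𝓘(ℝ, E) y
  let cotangent := fun y : M ↦ TangentSpace 𝓘(ℝ, E) y →L[ℝ] ℝ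
  refine ContMDiffAt.clm_apply_of_inCoordinates (b₁ := fun y : M ↦ y) (b₂ := fun y : M ↦ y)
    (F₁ := E →L[ℝ] ℝ) (E₁ := cotangent) (F₂ := E) (E₂ := tangent) ?_ (hξ x) contMDiffAt_id
  have hinv : ContMDiffAt 𝓘(ℝ, E) 𝓘(ℝ, (E →L[ℝ] ℝ) →L[ℝ] E) ∞ (fun y ↦
      (ContinuousLinearMap.inCoordinates E tangent (E →L[ℝ] ℝ) cotangent x y x y
        (g.val y)).inverse) x := by
    refine ContMDiffAt.comp x (g := ContinuousLinearMap.inverse) ?_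
      ((contMDiffAt_hom_bundle _).1 (g.smooth x)).2
    apply ContDiffAt.contMDiffAt
    apply ContinuousLinearMap.IsInvertible.contDiffAt_map_inverse
    rw [ContinuousLinearMap.inCoordinates_eq (FiberBundle.mem_baseSet_trivializationAt' x)
      (FiberBundle.mem_baseSet_trivializationAt' x)]
    exact ContinuousLinearMap.isInvertible_equiv.comp
      ((g.isInvertible x).comp ContinuousLinearMap.isInvertible_equiv)
  refine hinv.congr_of_eventuallyEq ?_
  filter_upwards [(trivializationAt E tangent x).open_baseSet.mem_nhds
      (FiberBundle.mem_baseSet_trivializationAt' x),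
    (trivializationAt (E →L[ℝ] ℝ) cotangent x).open_baseSet.mem_nhds
      (FiberBundle.mem_baseSet_trivializationAt' x)] with y hy hy'
  rw [ContinuousLinearMap.inCoordinates_eq hy hy', ContinuousLinearMap.inCoordinates_eq hy' hy]
  simp only [ContinuousLinearMap.inverse_equiv_comp, ContinuousLinearMap.inverse_comp_equiv,
    ContinuousLinearEquiv.symm_symm]
  rfl

variable [T2Space M]

variable {g} in
theorem IsCompatible.isParallel_endo (hg : g.IsCompatible nabla) :
    g.endo.IsParallel nabla where
  smooth_app hv := ⟨g.smooth_inverse hv.2, g.smoothBilin.flat hv.1⟩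
  genConn_app {v w} hv hw x := by
    have hflat {Y : VField E M} (hY : SmoothVField Y) :
        covForm nabla (fun y ↦ (v y).1) (flat g.val Y) x =
          g.val x (nabla (fun y ↦ (v y).1) Y x) :=
      covForm_flat hg.isLeibniz g.smoothBilin hg.isParallel_val hv.1 hY x
    refine Prod.ext ?_ (hflat hw.1)
    have hinverse := hflat (g.smooth_inverse hw.2)
    have hcancel : flat g.val (fun y ↦ (g.val y).inverse (w y).2) = fun y ↦ (w y).2 :=
      funext fun y ↦ g.val_inverse (w y).2
    rw [hcancel] at hinverse
    exact (g.inverse_val _).symm.trans (congrArg (g.val x).inverse hinverse.symm)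

end PseudoMetric

theorem isParallel_genMetric [FiniteDimensional ℝ E] [T2Space M] {g : PseudoMetric E M}
    {b : TwoForm E M} (hg : g.IsCompatible nabla) (hb : b.IsParallel nabla) :
    (genMetric g b).IsParallel nabla :=
  (isParallel_shear hg.isLeibniz b.smoothBilin hb.isParallel_val).comp
    (hg.isParallel_endo.comp
      (isParallel_shear hg.isLeibniz b.smoothBilin.neg hb.isParallel_val.neg))

end Metric

section NablaPlus

variable {E : Type*} [NormedAddCommGroup E] [NormedSpace ℝ E]
  {M : Type*} [TopologicalSpace M] [ChartedSpace E M] [IsManifold 𝓘(ℝ, E) ∞ M]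
  {x : M} {X Y Z : VField E M} {g : PseudoMetric E M} {b : TwoForm E M} {v : GenField E M}

/-- The right-hand side of the Koszul formula, i.e. `2 g(∇_X Y, Z)` for the Levi-Civita
connection `∇` of `g`. -/
def PseudoMetric.koszul (g : PseudoMetric E M) (X Y Z : VField E M) (x : M) : ℝ :=
  dirDeriv X (evalBilin g.val Y Z) x + dirDeriv Y (evalBilin g.val X Z) x
    - dirDeriv Z (evalBilin g.val X Y) x + evalBilin g.val (lieBr X Y) Z x
    - evalBilin g.val (lieBr X Z) Y x - evalBilin g.val (lieBr Y Z) X x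

theorem PseudoMetric.evalBilin_lieBr_swap (g : PseudoMetric E M) (X Y Z : VField E M) (x : M) :
    evalBilin g.val (lieBr X Y) Z x = -evalBilin g.val (lieBr Y X) Z x := by
  simp only [evalBilin, lieBr_swap X Y, map_neg, neg_apply]

theorem PseudoMetric.koszul_add_koszul_swap_right (g : PseudoMetric E M) (X Y Z : VField E M)
    (x : M) : g.koszul X Y Z x + g.koszul X Z Y x = 2 * dirDeriv X (evalBilin g.val Y Z) x := by
  rw [koszul, koszul, g.evalBilin_comm Z Y, g.evalBilin_lieBr_swap Z Y]
  ring

theorem PseudoMetric.koszul_sub_koszul_swap_left (g : PseudoMetric E M) (X Y Z : VField E M)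
    (x : M) : g.koszul X Y Z x - g.koszul Y X Z x = 2 * evalBilin g.val (lieBr X Y) Z x := by
  rw [koszul, koszul, g.evalBilin_comm Y X, g.evalBilin_lieBr_swap Y X]
  ring

theorem TwoForm.IsClosed.extDeriv_eq_zero (hb : b.IsClosed) (hX : SmoothVField X)
    (hY : SmoothVField Y) (hZ : SmoothVField Z) (x : M) : b.extDeriv X Y Z x = 0 :=
  hb X Y Z hX hY hZ x

theorem genMetric_apply (a : GenFiber E x) : genMetric g b x a =
    ((g.val x).inverse (a.2 - b.val x a.1),
      g.val x a.1 + b.val x ((g.val x).inverse (a.2 - b.val x a.1))) := by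
  simp [genMetric, shear, PseudoMetric.endo, sub_eq_add_neg]

theorem fst_genMetric_app_graph (g : PseudoMetric E M) (b : TwoForm E M) (Z : VField E M) :
    (fun y ↦ ((genMetric g b).app (graph b.val Z) y).1) = 0 := by
  ext y
  simp [GenEndo.app, genMetric_apply, graph, flat]

theorem pairing_liftPlus (g : PseudoMetric E M) (b : TwoForm E M) (X Y : VField E M) (x : M) :
    pairing (liftPlus g b X x) (liftPlus g b Y x) = 2 * evalBilin g.val X Y x := by
  simp only [pairing, liftPlus, evalBilin, add_apply]
  rw [g.symm x (Y x), b.skew x (Y x)]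
  ring

variable [FiniteDimensional ℝ E]

theorem genMetric_eq_self_iff (a : GenFiber E x) :
    genMetric g b x a = a ↔ a.2 = g.val x a.1 + b.val x a.1 := by
  rw [genMetric_apply]
  constructor
  · intro h
    have hfst := congrArg (g.val x) (congrArg Prod.fst h)
    rw [g.val_inverse] at hfst
    rw [← hfst]
    abel
  · intro h
    ext1 <;> simp [h, g.inverse_val]

theorem genMetric_app_liftPlus (g : PseudoMetric E M) (b : TwoForm E M) (X : VField E M) :
    (genMetric g b).app (liftPlus g b X) = liftPlus g b X :=
  funext fun y ↦ (genMetric_eq_self_iff (liftPlus g b X y)).2 rfl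

theorem IsPlusSection.eq_liftPlus (hv : IsPlusSection (genMetric g b) v) :
    v = liftPlus g b (fun y ↦ (v y).1) :=
  funext fun y ↦ Prod.ext rfl ((genMetric_eq_self_iff _).1 (hv.2 y))

theorem two_val_nablaPlus (X Y : VField E M) (x : M) (u : TangentSpace 𝓘(ℝ, E) x) :
    2 * g.val x (nablaPlus g b X Y x) u = g.val x (lieBr X Y x) u
      + (courant (liftMinus g b X) (liftPlus g b Y) x).2 u - b.val x (lieBr X Y x) u := by
  have h : (courant (liftMinus g b X) (liftPlus g b Y) x).1 = lieBr X Y x := fst_courant ..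
  rw [nablaPlus, genMetric_apply, h]
  simp only [Prod.smul_fst, Prod.fst_add, h, map_smul, map_add, g.val_inverse, smul_apply,
    add_apply, sub_apply, smul_eq_mul]
  ring

/-- Shearing `graph (±g)` by `b` changes the Courant bracket by `db`, so `∇⁺` differs from the
Levi-Civita connection by the three-form `db / 2`. -/
theorem two_evalBilin_nablaPlus (hX : MDiffAt (T% X) x) (hY : MDiffAt (T% Y) x)
    (hZ : MDiffAt (T% Z) x) :
    2 * evalBilin g.val (nablaPlus g b X Y) Z x = g.koszul X Y Z x + b.extDeriv X Y Z x := by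
  have hneg (U V : VField E M) : evalBilin (-g.val) U V = -evalBilin g.val U V := rfl
  have hdef : 2 * evalBilin g.val (nablaPlus g b X Y) Z x = evalBilin g.val (lieBr X Y) Z x
      + (courant (liftMinus g b X) (liftPlus g b Y) x).2 (Z x) - b.eval (lieBr X Y) Z x :=
    two_val_nablaPlus X Y x (Z x)
  rw [hdef, liftMinus_eq_shear_app, liftPlus_eq_shear_app,
    snd_courant_shear_graph_apply b g.smoothBilin.neg g.smoothBilin hX hY hZ,
    PseudoMetric.koszul, hneg, hneg, hneg, g.evalBilin_comm Y X, g.evalBilin_comm Y (lieBr X Z),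
    g.evalBilin_comm X (lieBr Y Z)]
  simp only [dirDeriv_neg, Pi.neg_apply]
  ring

theorem isCompatible_nablaPlus (g : PseudoMetric E M) (b : TwoForm E M) :
    g.IsCompatible (nablaPlus g b) := fun X Y Z x hX hY hZ ↦ by
  rw [g.evalBilin_comm Y (nablaPlus g b X Z)]
  linarith [two_evalBilin_nablaPlus (g := g) (b := b) hX hY hZ,
    two_evalBilin_nablaPlus (g := g) (b := b) hX hZ hY, b.extDeriv_swap_right X Y Z x,
    g.koszul_add_koszul_swap_right X Y Z x]

theorem isTorsionFree_nablaPlus [T2Space M] (g : PseudoMetric E M) (hb : b.IsClosed) :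
    IsTorsionFree (nablaPlus g b) := fun X Y hX hY x ↦ g.ext_of_smooth fun Z hZ ↦ by
  have hXY := two_evalBilin_nablaPlus (g := g) (b := b) (hX.mdiffAt x) (hY.mdiffAt x)
    (hZ.mdiffAt x)
  have hYX := two_evalBilin_nablaPlus (g := g) (b := b) (hY.mdiffAt x) (hX.mdiffAt x)
    (hZ.mdiffAt x)
  have hswap := g.koszul_sub_koszul_swap_left X Y Z x
  rw [hb.extDeriv_eq_zero hX hY hZ] at hXY
  rw [hb.extDeriv_eq_zero hY hX hZ] at hYX
  simp only [evalBilin, map_sub, sub_apply] at hXY hYX hswap ⊢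
  linarith

end NablaPlus

section PlusSections

variable {E : Type*} [NormedAddCommGroup E] [NormedSpace ℝ E] [FiniteDimensional ℝ E]
  {M : Type*} [TopologicalSpace M] [ChartedSpace E M] [IsManifold 𝓘(ℝ, E) ∞ M]
  {nabla : VField E M → VField E M → VField E M} {x : M} {X Y Z : VField E M}
  {g : PseudoMetric E M} {b : TwoForm E M} {v w : GenField E M}

theorem snd_courant_liftPlus_apply (hg : g.IsCompatible nabla) (ht : IsTorsionFree nabla)
    (hb : b.IsClosed) (hX : SmoothVField X) (hY : SmoothVField Y) (hZ : SmoothVField Z) (x : M) :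
    (courant (liftPlus g b X) (liftPlus g b Y) x).2 (Z x) =
      evalBilin g.val (lieBr X Y) Z x + b.eval (lieBr X Y) Z x
        + (evalBilin g.val (nabla Z X) Y x - evalBilin g.val X (nabla Z Y) x) := by
  have hXx := hX.mdiffAt x
  have hYx := hY.mdiffAt x
  have hZx := hZ.mdiffAt x
  rw [liftPlus_eq_shear_app, liftPlus_eq_shear_app,
    snd_courant_shear_graph_apply b g.smoothBilin g.smoothBilin hXx hYx hZx,
    hb.extDeriv_eq_zero hX hY hZ, g.evalBilin_comm Y X,
    hg X Y Z x hXx hYx hZx, hg Y X Z x hYx hXx hZx]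
  simp only [evalBilin, ht X Y hX hY x, ht X Z hX hZ x, ht Y Z hY hZ x, map_sub, sub_apply]
  rw [g.symm x (nabla Z X x)]
  ring

variable [T2Space M]

theorem pairing_genConn_liftPlus (hg : g.IsCompatible nabla) (hpar : b.IsParallel nabla)
    (hv : SmoothVField (fun y ↦ (v y).1)) (hX : SmoothVField X) (Y : VField E M) (x : M) :
    pairing (genConn nabla v (liftPlus g b X) x) (liftPlus g b Y x) =
      2 * evalBilin g.val (nabla (fun y ↦ (v y).1) X) Y x := by
  rw [liftPlus_eq_graph g b X, genConn_graph hg.isLeibniz (g.smoothBilin.add b.smoothBilin)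
    (hg.isParallel_val.add hpar.isParallel_val g.smoothBilin b.smoothBilin) hv hX]
  exact pairing_liftPlus g b _ Y x

/-- Test the condition on `u = Z + bZ`: then `Gu = gZ` has no vector part, so the right-hand side
of the condition vanishes. -/
theorem SymmCondition.evalBilin_nablaPlus_eq_zero (hclosed : b.IsClosed)
    (hpar : b.IsParallel (nablaPlus g b)) (hX : SmoothVField X)
    (h : SymmCondition g b (liftPlus g b X) (liftPlus g b Y)) (hZ : SmoothVField Z) (x : M) :
    evalBilin g.val (nablaPlus g b Z X) Y x = 0 := by
  have hg := isCompatible_nablaPlus g b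
  have hfst := fst_genMetric_app_graph g b Z
  have hsmooth : SmoothVField (fun y ↦ ((genMetric g b).app (graph b.val Z) y).1) :=
    ((isParallel_genMetric hg hpar).smooth_app (b.smoothBilin.graph hZ)).1
  have hsymm := h (graph b.val Z) (b.smoothBilin.graph hZ) x
  have hzero := (isTorsionFree_nablaPlus g hclosed).apply_zero_left hg.isLeibniz hX x
  rw [genMetric_app_liftPlus, pairing_genConn_liftPlus hg hpar hZ hX,
    pairing_genConn_liftPlus hg hpar hsmooth hX, hfst] at hsymm
  simpa [evalBilin, hzero, graph] using hsymm

theorem IsPlusSection.genMetric_courant (hclosed : b.IsClosed)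
    (hpar : b.IsParallel (nablaPlus g b)) (hv : IsPlusSection (genMetric g b) v)
    (hw : IsPlusSection (genMetric g b) w) (hvw : SymmCondition g b v w)
    (hwv : SymmCondition g b w v) (x : M) : genMetric g b x (courant v w x) = courant v w x := by
  have hv' := hv.eq_liftPlus
  have hw' := hw.eq_liftPlus
  have hX : SmoothVField (fun y ↦ (v y).1) := hv.1.1
  have hY : SmoothVField (fun y ↦ (w y).1) := hw.1.1
  generalize (fun y ↦ (v y).1 : VField E M) = X at hv' hX
  generalize (fun y ↦ (w y).1 : VField E M) = Y at hw' hY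
  subst hv' hw'
  rw [genMetric_eq_self_iff]
  refine covector_ext_of_smooth fun Z hZ ↦ ?_
  have hfst : (courant (liftPlus g b X) (liftPlus g b Y) x).1 = lieBr X Y x := fst_courant ..
  rw [hfst, snd_courant_liftPlus_apply (isCompatible_nablaPlus g b)
      (isTorsionFree_nablaPlus g hclosed) hclosed hX hY hZ,
    hvw.evalBilin_nablaPlus_eq_zero hclosed hpar hX hZ, g.evalBilin_comm X,
    hwv.evalBilin_nablaPlus_eq_zero hclosed hpar hY hZ, sub_zero, add_zero]
  rfl

end PlusSections

end GenGeom

end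

theorem mainTheorem7
    {E : Type*} [NormedAddCommGroup E] [NormedSpace ℝ E] [FiniteDimensional ℝ E]
    {M : Type*} [TopologicalSpace M] [T2Space M] [SecondCountableTopology M]
    [ChartedSpace E M] [IsManifold 𝓘(ℝ, E) ∞ M]
    (g : GenGeom.PseudoMetric E M) (b : GenGeom.TwoForm E M)
    (hpar : b.IsParallel (GenGeom.nablaPlus g b)) (hclosed : b.IsClosed) :
    GenGeom.NijenhuisIntegrable (GenGeom.connBracket (GenGeom.nablaPlus g b))
        (GenGeom.genMetric g b) ∧
      ((∀ v w : GenGeom.GenField E M, GenGeom.SmoothGenField v → GenGeom.SmoothGenField w →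
          GenGeom.SymmCondition g b v w) →
        GenGeom.CourantIntegrable (GenGeom.genMetric g b)) ∧
      (∀ v w : GenGeom.GenField E M,
        GenGeom.IsPlusSection (GenGeom.genMetric g b) v →
        GenGeom.IsPlusSection (GenGeom.genMetric g b) w →
        GenGeom.SymmCondition g b v w → GenGeom.SymmCondition g b w v →
          ∀ x, GenGeom.genMetric g b x (GenGeom.courant v w x) = GenGeom.courant v w x) :=
  have hmetric := GenGeom.isCompatible_nablaPlus g b
  have htorsionFree := GenGeom.isTorsionFree_nablaPlus g hclosed
  have hparallel : (GenGeom.genMetric g b).IsParallel (GenGeom.nablaPlus g b) :=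
    GenGeom.isParallel_genMetric hmetric hpar
  ⟨hparallel.nijenhuisIntegrable htorsionFree,
    fun hsymm _ _ hv hw ↦ hv.genMetric_courant hclosed hpar hw (hsymm _ _ hv.1 hw.1)
      (hsymm _ _ hw.1 hv.1),
    fun _ _ hv hw hvw hwv ↦ hv.genMetric_courant hclosed hpar hw hvw hwv⟩
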